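/- Let $N\in\mathbb N$ and let $G^N$ be the standard Gaussian measure on $\mathbb R^N$ (the $N$-fold product of the standard normal law on $\mathbb R$). For Borel probability measures $\mu,\nu$ on $\mathbb R^N$ let $\Pi(\mu,\nu)$ be the set of Borel probability measures on $\mathbb R^N\times\mathbb R^N$ with first marginal $\mu$ and second marginal $\nu$, and let $\mathcal F_t$ be the $\sigma$-algebra on $\mathbb R^N$ generated by the first $t$ coordinates. A plan $\gamma\in\Pi(\mu,\nu)$ is causal between $\mu$ and $\nu$ if for every $t\in\{1,\dots,N\}$ and $B\in\mathcal F_t$ the map $x\mapsto\gamma^x(B)$ coincides $\mu$-almost everywhere with an $\mathcal F_t$-measurable function, where $\gamma^x(dy)$ is the regular conditional distribution of the second component given the first. It is bicausal, written $\gamma\in\Pi_{bc}(\mu,\nu)$, if moreover its image under $(x,y)\mapsto(y,x)$ is causal between $\nu$ and $\mu$. Put $$\mathcal T_{bc,2}(\mu,\nu)=\inf_{\gamma\in\Pi_{bc}(\mu,\nu)}\int\sum_{i=1}^N|x_i-y_i|^2\,d\gamma,\qquad \mathcal T_{2}(\mu,\nu)=\inf_{\gamma\in\Pi(\mu,\nu)}\int\sum_{i=1}^N|x_i-y_i|^2\,d\gamma,$$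 with values in $[0,\infty]$, and let $\mathrm{Ent}(\nu|\mu)=\int\log\frac{d\nu}{d\mu}\,d\nu\in[0,\infty]$ if $\nu\ll\mu$ and $+\infty$ otherwise (relative entropy). Then for every Borel probability measure $\nu$ on $\mathbb R^N$ $$2\,\mathrm{Ent}(\nu|G^N)\ \ge\ \mathcal T_{bc,2}(G^N,\nu)\ \ge\ \mathcal T_2(G^N,\nu).$$ In particular this strengthens Talagrand's classical inequality $2\,\mathrm{Ent}(\nu|G^N)\ge\mathcal T_2(G^N,\nu)$. -/

import Mathlib

open MeasureTheory ProbabilityTheory InformationTheory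
open scoped ENNReal

noncomputable section

/-- The path space `ℝ^N` (only its Borel σ-algebra and its coordinates are used). -/
abbrev PathSpace (N : ℕ) : Type := Fin N → ℝ

/-- The filtration generated by the coordinate process on `ℝ^N`: the time `t : Fin N` stands for
the first `t + 1` coordinates, i.e. for those with index `i ≤ t`. -/
def coordFiltration (N : ℕ) :
    Filtration (Fin N) (MeasurableSpace.pi : MeasurableSpace (PathSpace N)) :=
  Filtration.piLE (X := fun _ : Fin N => ℝ)

/-- `Π(μ, ν)`: the transport plans, i.e. the probability measures on `ℝ^N × ℝ^N` with first
marginal `μ` and second marginal `ν`. -/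
def transportPlans {N : ℕ} (μ ν : Measure (PathSpace N)) :
    Set (ProbabilityMeasure (PathSpace N × PathSpace N)) :=
  {γ | (γ : Measure (PathSpace N × PathSpace N)).map Prod.fst = μ ∧
    (γ : Measure (PathSpace N × PathSpace N)).map Prod.snd = ν}

/-- `Π_c(μ, ν)`: the causal transport plans. For every time `t` and every event `B` of the second
process up to time `t`, the map `x ↦ γ^x(B)` (with `γ^x` the regular conditional kernel of `γ`
given the first component) is measurable with respect to the first process up to time `t`, up to
modification on a `μ`-null set. -/
def causalPlans {N : ℕ} (μ ν : Measure (PathSpace N)) :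
    Set (ProbabilityMeasure (PathSpace N × PathSpace N)) :=
  {γ | γ ∈ transportPlans μ ν ∧
    ∀ (t : Fin N) (B : Set (PathSpace N)), MeasurableSet[coordFiltration N t] B →
      ∃ f : PathSpace N → ℝ≥0∞, Measurable[coordFiltration N t] f ∧
        (fun x => (γ : Measure (PathSpace N × PathSpace N)).condKernel x B) =ᵐ[μ] f}

/-- `Π_bc(μ, ν)`: the bicausal transport plans, causal from `μ` to `ν` and, after exchanging the
two components, from `ν` to `μ`. -/
def bicausalPlans {N : ℕ} (μ ν : Measure (PathSpace N)) :
    Set (ProbabilityMeasure (PathSpace N × PathSpace N)) :=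
  {γ | γ ∈ causalPlans μ ν ∧ γ.map measurable_swap.aemeasurable ∈ causalPlans ν μ}

/-- The quadratic cost `|x - y|² = ∑ᵢ (xᵢ - yᵢ)²` (the square of the Euclidean distance). -/
def quadraticCost {N : ℕ} (p : PathSpace N × PathSpace N) : ℝ≥0∞ :=
  ENNReal.ofReal (∑ i, (p.1 i - p.2 i) ^ 2)

/-- `𝒯₂(μ, ν)`: the value of the optimal transport problem with quadratic cost. -/
def transportCost {N : ℕ} (μ ν : Measure (PathSpace N)) : ℝ≥0∞ :=
  ⨅ γ ∈ transportPlans μ ν,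
    ∫⁻ p, quadraticCost p ∂(γ : Measure (PathSpace N × PathSpace N))

/-- `𝒯_{bc,2}(μ, ν)`: the value of the bicausal optimal transport problem with quadratic cost. -/
def bicausalTransportCost {N : ℕ} (μ ν : Measure (PathSpace N)) : ℝ≥0∞ :=
  ⨅ γ ∈ bicausalPlans μ ν,
    ∫⁻ p, quadraticCost p ∂(γ : Measure (PathSpace N × PathSpace N))

/-- `G^N`: the standard Gaussian measure on `ℝ^N`. -/
def stdGaussianMeasure (N : ℕ) : Measure (PathSpace N) :=
  Measure.pi fun _ : Fin N => gaussianReal 0 1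

end

/-! The second inequality is the inclusion of bicausal plans in all plans. For the first, only `ν ≪
G^N` matters, and the plan used is the graph of the Knothe–Rosenblatt map `T`: its `i`-th coordinate
is the increasing rearrangement, given the past, of the standard normal law onto the conditional law
of the `i`-th coordinate of `ν`. Absolute continuity leaves the conditional laws without atoms, so
the rearrangements are invertible almost everywhere. Hence `T` has an inverse `S` of the same
triangular form, and the graph is causal in both directions (`bicausalTransportCost_le_lintegral`).

The cost is a sum of conditional one-dimensional costs and the entropy satisfies the chain rule, so
induction on `N` reduces the estimate to one dimension (`integral_sq_sub_le_integral_llr`). There,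
let `S` be increasing from `ρ = f·φ dx` onto the Gaussian with density `φ`. Formally `S' = fφ /
φ(S)`, and `log S' ≥ 1 - 1/S'` gives `log f ≥ 1 - 1/S' + (y² - S²)/2`. Gaussian integration by parts
reads `∫ 1/S' dρ = ∫ y S dρ`, and with `∫ S² dρ = 1` the integrated bound is `Ent ≥ ½ ∫ (y - S)²
dρ`.

No derivative is ever taken: `1/S'` is replaced by `φ(S)/(fφ)`, and the integration by parts by
Fubini applied to `J y = ∫_{w > y} S dρ`, which equals `φ(S y)` because `S` is increasing. -/

open Set Filter Topology

/-! ### Quantile functions and increasing rearrangements on the line. -/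

/-- A quantile function of `ρ`, set to `0` outside the open unit interval. -/
noncomputable def quantile (ρ : Measure ℝ) (u : ℝ) : ℝ :=
  open Classical in if u ∈ Ioo (0 : ℝ) 1 then sInf {c | u ≤ cdf ρ c} else 0

/-- The increasing rearrangement of `ρ` onto `σ`. -/
noncomputable def monotoneRearrangement (ρ σ : Measure ℝ) (z : ℝ) : ℝ := quantile σ (cdf ρ z)

theorem bddBelow_setOf_le_cdf (ρ : Measure ℝ) {u : ℝ} (hu : 0 < u) :
    BddBelow {c | u ≤ cdf ρ c} := by
  obtain ⟨a, ha⟩ := ((tendsto_cdf_atBot ρ).eventually_lt_const hu).exists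
  refine ⟨a, fun c hc => ?_⟩
  by_contra! h
  exact absurd ((monotone_cdf ρ h.le).trans_lt ha) (not_lt.mpr hc)

theorem nonempty_setOf_le_cdf (ρ : Measure ℝ) {u : ℝ} (hu : u < 1) :
    {c | u ≤ cdf ρ c}.Nonempty := by
  obtain ⟨a, ha⟩ := ((tendsto_cdf_atTop ρ).eventually_const_lt hu).exists
  exact ⟨a, ha.le⟩

/-- Right continuity of the cdf makes the infimum attained, which yields the Galois connection from
which the later facts on quantiles follow. -/
theorem quantile_le_iff (ρ : Measure ℝ) {u : ℝ} (hu : u ∈ Ioo (0 : ℝ) 1) (c : ℝ) :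
    quantile ρ u ≤ c ↔ u ≤ cdf ρ c := by
  rw [quantile, if_pos hu]
  refine ⟨fun h => ?_, fun h => csInf_le (bddBelow_setOf_le_cdf ρ hu.1) h⟩
  have key : ∀ d, c < d → u ≤ cdf ρ d := fun d hd => by
    obtain ⟨e, he, hed⟩ := exists_lt_of_csInf_lt (nonempty_setOf_le_cdf ρ hu.2) (h.trans_lt hd)
    exact le_trans he (monotone_cdf ρ hed.le)
  have hr : ContinuousWithinAt (cdf ρ) (Ioi c) c :=
    continuousWithinAt_Ioi_iff_Ici.mpr ((cdf ρ).right_continuous c)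
  exact ge_of_tendsto hr (eventually_nhdsWithin_of_forall key)

theorem quantile_monotoneOn (ρ : Measure ℝ) : MonotoneOn (quantile ρ) (Ioo 0 1) :=
  fun _ hu _ hv huv =>
    (quantile_le_iff ρ hu _).mpr (huv.trans ((quantile_le_iff ρ hv _).mp le_rfl))

theorem monotoneOn_monotoneRearrangement (ρ σ : Measure ℝ) :
    MonotoneOn (monotoneRearrangement ρ σ) (cdf ρ ⁻¹' Ioo 0 1) :=
  fun _ hx _ hy hxy => quantile_monotoneOn σ hx hy (monotone_cdf ρ hxy)

theorem continuous_cdf (ρ : Measure ℝ) [IsProbabilityMeasure ρ] [NullSingletonClass ρ] :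
    Continuous (cdf ρ) := by
  rw [continuous_iff_continuousAt]
  intro a
  rw [continuousAt_iff_continuous_left'_right',
    (monotone_cdf ρ).continuousWithinAt_Iio_iff_leftLim_eq]
  refine ⟨?_, continuousWithinAt_Ioi_iff_Ici.mpr ((cdf ρ).right_continuous a)⟩
  have h : (cdf ρ).measure {a} = 0 := by rw [measure_cdf]; exact measure_singleton a
  rw [StieltjesFunction.measure_singleton, ENNReal.ofReal_eq_zero] at h
  exact le_antisymm ((monotone_cdf ρ).leftLim_le le_rfl) (by linarith)

theorem cdf_quantile (ρ : Measure ℝ) [IsProbabilityMeasure ρ] [NullSingletonClass ρ] {u : ℝ}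
    (hu : u ∈ Ioo (0 : ℝ) 1) : cdf ρ (quantile ρ u) = u := by
  refine le_antisymm ?_ ((quantile_le_iff ρ hu _).mp le_rfl)
  have hl : ContinuousWithinAt (cdf ρ) (Iio (quantile ρ u)) (quantile ρ u) :=
    (continuous_cdf ρ).continuousWithinAt
  refine le_of_tendsto hl (eventually_nhdsWithin_of_forall fun c hc => ?_)
  by_contra! h
  exact absurd ((quantile_le_iff ρ hu c).mpr h.le) (not_le.mpr hc)

/-- Probability integral transform: without atoms the cdf is continuous, so for `0 < v < 1` the
sublevel set is a closed half-line at whose endpoint the cdf equals `v`. The value at `0` follows by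
letting `v` decrease to `0`. -/
theorem measureReal_cdf_le (ρ : Measure ℝ) [IsProbabilityMeasure ρ] [NullSingletonClass ρ] {u : ℝ}
    (hu : u ∈ Icc (0 : ℝ) 1) : ρ.real {z | cdf ρ z ≤ u} = u := by
  have hIoo : ∀ v ∈ Ioo (0 : ℝ) 1, ρ.real {z | cdf ρ z ≤ v} = v := by
    intro v hv
    have hbdd : BddAbove {z | cdf ρ z ≤ v} := by
      obtain ⟨a, ha⟩ := ((tendsto_cdf_atTop ρ).eventually_const_lt hv.2).exists
      refine ⟨a, fun c hc => ?_⟩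
      by_contra! h
      exact absurd (ha.trans_le (monotone_cdf ρ h.le)) (not_lt.mpr hc)
    have hmem : quantile ρ v ∈ {z | cdf ρ z ≤ v} := (cdf_quantile ρ hv).le
    have hcl : IsClosed {z | cdf ρ z ≤ v} := isClosed_le (continuous_cdf ρ) continuous_const
    have hsup := hcl.csSup_mem ⟨_, hmem⟩ hbdd
    have heq : {z | cdf ρ z ≤ v} = Iic (sSup {z | cdf ρ z ≤ v}) := by
      ext z
      exact ⟨fun h => le_csSup hbdd h, fun h => (monotone_cdf ρ h).trans hsup⟩
    rw [heq, ← cdf_eq_real]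
    refine le_antisymm hsup ?_
    calc v = cdf ρ (quantile ρ v) := (cdf_quantile ρ hv).symm
      _ ≤ _ := monotone_cdf ρ (le_csSup hbdd hmem)
  rcases eq_or_lt_of_le hu.2 with rfl | h1
  · simp [cdf_le_one]
  rcases eq_or_lt_of_le hu.1 with rfl | h0
  · refine le_antisymm (le_of_forall_gt_imp_ge_of_dense fun v hv => ?_) measureReal_nonneg
    rcases lt_or_ge v 1 with hv1 | hv1
    · refine le_trans (measureReal_mono fun z hz => ?_) (hIoo v ⟨hv, hv1⟩).le
      exact le_trans (α := ℝ) hz hv.le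
    · exact measureReal_le_one.trans hv1
  · exact hIoo u ⟨h0, h1⟩

theorem ae_cdf_mem_Ioo (ρ : Measure ℝ) [IsProbabilityMeasure ρ] [NullSingletonClass ρ] :
    ∀ᵐ z ∂ρ, cdf ρ z ∈ Ioo (0 : ℝ) 1 := by
  have h0 : ∀ᵐ z ∂ρ, 0 < cdf ρ z := by
    have h := measureReal_cdf_le ρ (u := 0) (by simp)
    rw [measureReal_eq_zero_iff] at h
    simpa [ae_iff] using h
  have h1 : ∀ᵐ z ∂ρ, cdf ρ z < 1 := by
    have hm : MeasurableSet {z | cdf ρ z < 1} :=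
      measurableSet_lt (monotone_cdf ρ).measurable measurable_const
    have h : ρ.real {z | cdf ρ z < 1} = 1 := by
      refine le_antisymm measureReal_le_one (le_of_forall_lt_imp_le_of_dense fun v hv => ?_)
      rcases lt_or_ge v 0 with hv0 | hv0
      · exact hv0.le.trans measureReal_nonneg
      · refine le_trans (measureReal_cdf_le ρ ⟨hv0, hv.le⟩).ge (measureReal_mono fun z hz => ?_)
        exact lt_of_le_of_lt (α := ℝ) hz hv
    rw [ae_iff, ← compl_ofPred, prob_compl_eq_zero_iff hm]
    simpa [measureReal_def, ENNReal.toReal_eq_one_iff] using h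
  filter_upwards [h0, h1] with z a b using ⟨a, b⟩

/-- The measure is allowed to vary with the parameter because the Knothe–Rosenblatt map rearranges
onto a conditional law that depends on the past. -/
theorem measurable_quantile_of_measurable_cdf {α : Type*} [MeasurableSpace α]
    {σ : α → Measure ℝ} {u : α → ℝ} (hσ : ∀ c, Measurable fun a => cdf (σ a) c)
    (hu : Measurable u) : Measurable fun a => quantile (σ a) (u a) := by
  have hD : MeasurableSet {a | u a ∈ Ioo (0 : ℝ) 1} := hu measurableSet_Ioo
  refine measurable_of_Iic fun c => ?_
  have : (fun a => quantile (σ a) (u a)) ⁻¹' Iic c =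
      ({a | u a ∈ Ioo (0 : ℝ) 1} ∩ {a | u a ≤ cdf (σ a) c}) ∪
        ({a | u a ∈ Ioo (0 : ℝ) 1}ᶜ ∩ {_a | (0 : ℝ) ≤ c}) := by
    ext a
    by_cases h : u a ∈ Ioo (0 : ℝ) 1
    · simp [h, quantile_le_iff, -mem_Ioo]
    · simp [h, quantile, -mem_Ioo]
  rw [this]
  exact (hD.inter (measurableSet_le hu (hσ c))).union (hD.compl.inter (.const _))

theorem measurable_monotoneRearrangement (ρ σ : Measure ℝ) :
    Measurable (monotoneRearrangement ρ σ) :=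
  measurable_quantile_of_measurable_cdf (fun _ => measurable_const) (monotone_cdf ρ).measurable

theorem measurable_cdf_kernel {α : Type*} [MeasurableSpace α] (κ : Kernel α ℝ) [IsMarkovKernel κ] :
    Measurable fun p : α × ℝ => cdf (κ p.1) p.2 := by
  simp_rw [cdf_eq_real, measureReal_def]
  refine Measurable.ennreal_toReal ?_
  have hs : MeasurableSet {q : (α × ℝ) × ℝ | q.2 ≤ q.1.2} :=
    measurableSet_le measurable_snd measurable_fst.snd
  exact Kernel.measurable_kernel_prodMk_left (κ := κ.comap Prod.fst measurable_fst) hs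

theorem measurable_monotoneRearrangement_kernel_left {α Ω : Type*} [MeasurableSpace α]
    [MeasurableSpace Ω] (κ : Kernel α ℝ) [IsMarkovKernel κ] (σ : Measure ℝ) {f : Ω → α} {h : Ω → ℝ}
    (hf : Measurable f) (hh : Measurable h) :
    Measurable fun a => monotoneRearrangement (κ (f a)) σ (h a) :=
  measurable_quantile_of_measurable_cdf (fun _ => measurable_const)
    ((measurable_cdf_kernel κ).comp (hf.prodMk hh))

theorem measurable_monotoneRearrangement_kernel_right {α Ω : Type*} [MeasurableSpace α]
    [MeasurableSpace Ω] (κ : Kernel α ℝ) [IsMarkovKernel κ] (ρ : Measure ℝ) {f : Ω → α} {h : Ω → ℝ}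
    (hf : Measurable f) (hh : Measurable h) :
    Measurable fun a => monotoneRearrangement ρ (κ (f a)) (h a) :=
  measurable_quantile_of_measurable_cdf
    (fun _ => (measurable_cdf_kernel κ).comp (hf.prodMk measurable_const))
    ((monotone_cdf ρ).measurable.comp hh)

theorem map_monotoneRearrangement (ρ σ : Measure ℝ) [IsProbabilityMeasure ρ]
    [NullSingletonClass ρ] [IsProbabilityMeasure σ] :
    ρ.map (monotoneRearrangement ρ σ) = σ := by
  have hm := measurable_monotoneRearrangement ρ σ
  have := Measure.isProbabilityMeasure_map (μ := ρ) hm.aemeasurable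
  refine Measure.ext_of_Iic _ _ fun c => ?_
  rw [Measure.map_apply hm measurableSet_Iic, ← ofReal_cdf,
    ← measureReal_cdf_le ρ ⟨cdf_nonneg σ c, cdf_le_one σ c⟩, ofReal_measureReal]
  refine measure_congr ?_
  filter_upwards [ae_cdf_mem_Ioo ρ] with z hz
  exact propext (quantile_le_iff σ hz c)

/-- The identity can only fail where the cdf is flat to the left of `z`. Such a `z` has a rational
`r < z` with `cdf ρ z ≤ cdf ρ r`, and for each `r` these points form a null set. -/
theorem ae_quantile_cdf (ρ : Measure ℝ) [IsProbabilityMeasure ρ] [NullSingletonClass ρ] :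
    ∀ᵐ z ∂ρ, quantile ρ (cdf ρ z) = z := by
  have h : ∀ r : ℚ, ∀ᵐ z ∂ρ, ¬ ((r : ℝ) < z ∧ cdf ρ z ≤ cdf ρ r) := by
    intro r
    have hsub : Iic (r : ℝ) ⊆ {z | cdf ρ z ≤ cdf ρ r} := fun z hz => monotone_cdf ρ hz
    have h0 : ρ ({z | cdf ρ z ≤ cdf ρ r} \ Iic (r : ℝ)) = 0 := by
      rw [← measureReal_eq_zero_iff, measureReal_sdiff hsub measurableSet_Iic,
        measureReal_cdf_le ρ ⟨cdf_nonneg ρ _, cdf_le_one ρ _⟩, cdf_eq_real, sub_self]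
    rw [ae_iff]
    convert h0 using 2
    ext z
    simp [and_comm]
  filter_upwards [ae_all_iff.mpr h, ae_cdf_mem_Ioo ρ] with z hz hz'
  refine le_antisymm ((quantile_le_iff ρ hz' z).mpr le_rfl) ?_
  by_contra! hlt
  obtain ⟨r, hr, hrz⟩ := exists_rat_btwn hlt
  exact hz r ⟨hrz, (quantile_le_iff ρ hz' r).mp hr.le⟩

theorem ae_monotoneRearrangement_leftInverse (ρ σ : Measure ℝ) [IsProbabilityMeasure ρ]
    [NullSingletonClass ρ] [IsProbabilityMeasure σ] [NullSingletonClass σ] :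
    ∀ᵐ z ∂ρ, monotoneRearrangement σ ρ (monotoneRearrangement ρ σ z) = z := by
  filter_upwards [ae_quantile_cdf ρ, ae_cdf_mem_Ioo ρ] with z hz hz'
  rw [monotoneRearrangement, monotoneRearrangement, cdf_quantile σ hz', hz]

/-! ### Moments and tail integrals of the standard normal law. -/

theorem integral_sq_gaussianReal_zero_one : ∫ z, z ^ 2 ∂(gaussianReal 0 1) = 1 := by
  have h := variance_eq_sub (memLp_id_gaussianReal (μ := 0) (v := 1) 2)
  rw [variance_id_gaussianReal] at h
  simpa [integral_id_gaussianReal] using h.symm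

theorem tendsto_gaussianPDFReal_atTop : Tendsto (gaussianPDFReal 0 1) atTop (𝓝 0) := by
  have h : Tendsto (fun x : ℝ => -(x ^ 2 / 2)) atTop atBot :=
    tendsto_neg_atTop_atBot.comp ((tendsto_pow_atTop two_ne_zero).atTop_div_const two_pos)
  have h2 := (Real.tendsto_exp_atBot.comp h).const_mul (√(2 * Real.pi * 1))⁻¹
  rw [mul_zero] at h2
  refine h2.congr fun x => ?_
  simp [gaussianPDFReal, neg_div]

theorem hasDerivAt_gaussianPDFReal (x : ℝ) :
    HasDerivAt (gaussianPDFReal 0 1) (-(gaussianPDFReal 0 1 x * x)) x := by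
  have h1 : HasDerivAt (fun x : ℝ => -(x ^ 2) / 2) (-x) x :=
    (((hasDerivAt_pow 2 x).neg).div_const 2).congr_deriv (by simp; ring)
  have h := h1.exp.const_mul (√(2 * Real.pi * 1))⁻¹
  refine HasDerivAt.congr_of_eventuallyEq (h.congr_deriv ?_) (Eventually.of_forall fun y => ?_)
  · simp [gaussianPDFReal]; ring
  · simp [gaussianPDFReal]

theorem integrable_id_gaussianReal_zero_one : Integrable (fun z : ℝ => z) (gaussianReal 0 1) :=
  (memLp_id_gaussianReal (μ := 0) (v := 1) 1).integrable le_rfl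

theorem integrable_gaussianReal_zero_one_iff {h : ℝ → ℝ} :
    Integrable h (gaussianReal 0 1) ↔ Integrable fun x => gaussianPDFReal 0 1 x * h x := by
  rw [gaussianReal_of_var_ne_zero _ one_ne_zero,
    integrable_withDensity_iff_integrable_smul' (measurable_gaussianPDF 0 1)
      (ae_of_all _ fun _ => gaussianPDF_lt_top)]
  simp

theorem setIntegral_Ioi_id_gaussianReal (a : ℝ) :
    ∫ z in Ioi a, z ∂(gaussianReal 0 1) = gaussianPDFReal 0 1 a := by
  have hint : Integrable fun x => gaussianPDFReal 0 1 x * x :=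
    integrable_gaussianReal_zero_one_iff.mp integrable_id_gaussianReal_zero_one
  rw [← integral_indicator measurableSet_Ioi, integral_gaussianReal_eq_integral_smul one_ne_zero]
  have h1 : (fun x => gaussianPDFReal 0 1 x • (Ioi a).indicator (fun z : ℝ => z) x) =
      (Ioi a).indicator fun x => gaussianPDFReal 0 1 x * x := by
    ext x
    by_cases hx : x ∈ Ioi a <;> simp [hx, -mem_Ioi]
  rw [h1, integral_indicator measurableSet_Ioi,
    integral_Ioi_of_hasDerivAt_of_tendsto' (f := fun x => -gaussianPDFReal 0 1 x) (m := 0)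
      (fun x _ => (hasDerivAt_gaussianPDFReal x).neg.congr_deriv (neg_neg _)) hint.integrableOn
      (by simpa using tendsto_gaussianPDFReal_atTop.neg)]
  ring

/-! ### The one-dimensional inequality, for an increasing map onto the Gaussian. -/

section Monotone

variable {ρ : Measure ℝ} {S : ℝ → ℝ} {D : Set ℝ}

theorem integrable_of_map_eq_gaussianReal (hS : Measurable S) (hmap : ρ.map S = gaussianReal 0 1) :
    Integrable S ρ := by
  have h := integrable_id_gaussianReal_zero_one
  rw [← hmap, integrable_map_measure measurable_id'.aestronglyMeasurable hS.aemeasurable] at h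
  exact h

/-- Since `S` is increasing and its level sets are null, `Ioi y` is almost everywhere the preimage
of `Ioi (S y)`; the tail integral is then a Gaussian one. Monotonicity is only asked on a set `D` of
full measure, since the rearrangement takes a default value where the cdf is `0` or `1`. -/
theorem setIntegral_Ioi_eq_gaussianPDFReal (hS : Measurable S)
    (hmap : ρ.map S = gaussianReal 0 1) (hD : ∀ᵐ w ∂ρ, w ∈ D) (hmono : MonotoneOn S D)
    {y : ℝ} (hy : y ∈ D) : ∫ w in Ioi y, S w ∂ρ = gaussianPDFReal 0 1 (S y) := by
  have hne : ∀ᵐ w ∂ρ, S w ≠ S y := by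
    have := nullSingletonClass_gaussianReal (μ := 0) (v := 1) one_ne_zero
    have h0 : gaussianReal 0 1 {S y} = 0 := measure_singleton _
    rw [← hmap, Measure.map_apply hS (measurableSet_singleton _)] at h0
    rw [ae_iff]
    simpa only [ne_eq, not_not] using! h0
  have hset : (Ioi y : Set ℝ) =ᵐ[ρ] S ⁻¹' Ioi (S y) := by
    filter_upwards [hD, hne] with w hw hw'
    refine propext ⟨fun h => lt_of_le_of_ne (hmono hy hw (le_of_lt h)) hw'.symm, fun h => ?_⟩
    by_contra h'
    exact absurd (hmono hw hy (not_lt.mp h')) (not_le.mpr h)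
  rw [setIntegral_congr_set hset, ← setIntegral_Ioi_id_gaussianReal, ← hmap,
    setIntegral_map measurableSet_Ioi measurable_id'.aestronglyMeasurable hS.aemeasurable]

theorem setIntegral_Ioi_add_setIntegral_Iic (hS : Measurable S)
    (hmap : ρ.map S = gaussianReal 0 1) (y : ℝ) :
    ∫ w in Ioi y, S w ∂ρ + ∫ w in Iic y, S w ∂ρ = 0 := by
  have h0 : ∫ w, S w ∂ρ = 0 := by
    have h := integral_id_gaussianReal (μ := 0) (v := 1)
    rwa [← hmap, integral_map hS.aemeasurable measurable_id'.aestronglyMeasurable] at h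
  rw [← h0, ← integral_add_compl (s := Ioi y) measurableSet_Ioi
    (integrable_of_map_eq_gaussianReal hS hmap), compl_Ioi]

/-- Either `S ≥ 0` on `D` beyond `y`, or `S` is negative somewhere beyond `y`, hence nonpositive
before `y`; in the second case the mean being zero gives the sign. -/
theorem setIntegral_Ioi_nonneg (hS : Measurable S)
    (hmap : ρ.map S = gaussianReal 0 1) (hD : ∀ᵐ w ∂ρ, w ∈ D) (hmono : MonotoneOn S D)
    (y : ℝ) : 0 ≤ ∫ w in Ioi y, S w ∂ρ := by
  by_cases h : ∀ w ∈ D, y < w → 0 ≤ S w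
  · refine setIntegral_nonneg_of_ae_restrict ?_
    filter_upwards [ae_restrict_of_ae hD, ae_restrict_mem measurableSet_Ioi] with w hw hw'
      using h w hw hw'
  · push Not at h
    obtain ⟨w₀, hw₀, hyw, hneg⟩ := h
    have h1 : ∫ w in Iic y, S w ∂ρ ≤ 0 := by
      refine setIntegral_nonpos_of_ae_restrict ?_
      filter_upwards [ae_restrict_of_ae hD, ae_restrict_mem measurableSet_Iic] with w hw hw'
      exact (hmono hw hw₀ (le_trans hw' hyw.le)).trans hneg.le
    linarith [setIntegral_Ioi_add_setIntegral_Iic hS hmap y]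

variable [IsProbabilityMeasure ρ]

/-- Integration by parts in Fubini form, which needs no regularity of `S`. -/
theorem integrable_and_integral_setIntegral_Ioi (hS : Measurable S)
    (hmap : ρ.map S = gaussianReal 0 1) (hwS : Integrable (fun w => w * S w) ρ) :
    Integrable (fun y => ∫ w in Ioi y, S w ∂ρ) ∧
      ∫ y, ∫ w in Ioi y, S w ∂ρ = ∫ w, w * S w ∂ρ := by
  -- Writing `w` as the signed length of the interval between `0` and `w` gives `∫ k w y dy = w * S
  -- w`. Integrating in `w` instead gives the upper tail for `y ≥ 0` and minus the lower tail for `y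
  -- < 0`; these agree because `S` has mean zero.
  let k : ℝ → ℝ → ℝ := fun w y =>
    (Ico 0 w).indicator (fun _ => S w) y - (Ico w 0).indicator (fun _ => S w) y
  have hkm : Measurable (Function.uncurry k) := by
    have h1 : MeasurableSet {p : ℝ × ℝ | 0 ≤ p.2 ∧ p.2 < p.1} :=
      (measurableSet_le measurable_const measurable_snd).inter
        (measurableSet_lt measurable_snd measurable_fst)
    have h2 : MeasurableSet {p : ℝ × ℝ | p.1 ≤ p.2 ∧ p.2 < 0} :=
      (measurableSet_le measurable_fst measurable_snd).inter
        (measurableSet_lt measurable_snd measurable_const)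
    exact ((hS.comp measurable_fst).indicator h1).sub ((hS.comp measurable_fst).indicator h2)
  have hk_eq : ∀ w, (0 ≤ w ∧ k w = (Ico 0 w).indicator fun _ => S w) ∨
      (w ≤ 0 ∧ k w = (Ico w 0).indicator fun _ => -S w) := by
    intro w
    rcases le_total 0 w with hw | hw
    · exact Or.inl ⟨hw, by ext y; simp [k, Ico_eq_empty (not_lt.mpr hw)]⟩
    · refine Or.inr ⟨hw, ?_⟩
      ext y
      by_cases hy : y ∈ Ico w 0 <;> simp [k, Ico_eq_empty (not_lt.mpr hw), hy, -mem_Ico]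
  have hkint : ∀ w, ∫ y, k w y = w * S w := by
    intro w
    rcases hk_eq w with ⟨hw, h⟩ | ⟨hw, h⟩ <;>
      rw [h, integral_indicator measurableSet_Ico] <;> simp [measureReal_def, hw]
  have hknorm : ∀ w, ∫ y, ‖k w y‖ = ‖w * S w‖ := by
    intro w
    rcases hk_eq w with ⟨hw, h⟩ | ⟨hw, h⟩ <;>
      simp_rw [h, norm_indicator_eq_indicator_norm] <;>
      rw [integral_indicator measurableSet_Ico] <;>
      simp [measureReal_def, hw, abs_of_nonneg, abs_of_nonpos]
  have hki : Integrable (Function.uncurry k) (ρ.prod volume) := by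
    rw [integrable_prod_iff hkm.aestronglyMeasurable]
    refine ⟨ae_of_all _ fun w => ?_, hwS.norm.congr (ae_of_all _ fun w => (hknorm w).symm)⟩
    change Integrable (k w) volume
    rcases hk_eq w with ⟨hw, h⟩ | ⟨hw, h⟩ <;> rw [h] <;>
      exact (integrableOn_const (by simp)).integrable_indicator measurableSet_Ico
  have hkJ : ∀ y, ∫ w, k w y ∂ρ = ∫ w in Ioi y, S w ∂ρ := by
    intro y
    rcases le_or_gt 0 y with hy | hy
    · have : (fun w => k w y) = (Ioi y).indicator S := by
        ext w
        simp [k, indicator_apply, hy, not_lt.mpr hy]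
      rw [this, integral_indicator measurableSet_Ioi]
    · have : (fun w => k w y) = fun w => -(Iic y).indicator S w := by
        ext w
        simp [k, indicator_apply, hy, not_le.mpr hy]
      rw [this, integral_neg, integral_indicator measurableSet_Iic]
      linarith [setIntegral_Ioi_add_setIntegral_Iic hS hmap y]
  constructor
  · exact hki.integral_prod_right.congr (ae_of_all _ hkJ)
  · simp_rw [← hkJ, ← hkint]
    exact (integral_integral_swap hki).symm

/-- Young's inequality for the conjugate pair `a log a - a` and `exp b`. -/
theorem Real.mul_le_mul_log_sub_add_exp {a : ℝ} (ha : 0 ≤ a) (b : ℝ) :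
    a * b ≤ a * Real.log a - a + Real.exp b := by
  rcases ha.eq_or_lt with rfl | ha
  · simpa using (Real.exp_pos b).le
  · have h := Real.add_one_le_exp (b - Real.log a)
    rw [Real.exp_sub, Real.exp_log ha, le_div_iff₀ ha] at h
    linarith

/-- Finite entropy gives a second moment: Young's inequality with `a` the density and `b = C w²`,
where `exp (C w²)` is Gaussian integrable by Fernique's theorem. -/
theorem integrable_sq_of_integrable_llr (hac : ρ ≪ gaussianReal 0 1)
    (hllr : Integrable (llr ρ (gaussianReal 0 1)) ρ) : Integrable (fun w : ℝ => w ^ 2) ρ := by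
  obtain ⟨C, hC, hexp⟩ := IsGaussian.exists_integrable_exp_sq (gaussianReal 0 1)
  rw [← integrable_rnDeriv_smul_iff hac]
  rw [← integrable_rnDeriv_mul_log_iff hac] at hllr
  have hf : Integrable (fun w => (ρ.rnDeriv (gaussianReal 0 1) w).toReal) (gaussianReal 0 1) :=
    Measure.integrable_toReal_rnDeriv
  refine (((hllr.sub hf).add hexp).const_mul C⁻¹).mono' ?_ (ae_of_all _ fun w => ?_)
  · exact Measurable.aestronglyMeasurable (by fun_prop)
  · have hnn : 0 ≤ (ρ.rnDeriv (gaussianReal 0 1) w).toReal := ENNReal.toReal_nonneg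
    have h := Real.mul_le_mul_log_sub_add_exp hnn (C * ‖w‖ ^ 2)
    rw [smul_eq_mul, Real.norm_of_nonneg (by positivity), le_inv_mul_iff₀ hC]
    simp only [Real.norm_eq_abs, sq_abs, Pi.add_apply, Pi.sub_apply] at h ⊢
    linarith

/-- The one-dimensional transport-entropy inequality for an increasing map `S` onto the Gaussian. -/
theorem integral_sq_sub_le_integral_llr (hac : ρ ≪ gaussianReal 0 1)
    (hllr : Integrable (llr ρ (gaussianReal 0 1)) ρ) (hS : Measurable S)
    (hmap : ρ.map S = gaussianReal 0 1) (hD : ∀ᵐ w ∂ρ, w ∈ D) (hmono : MonotoneOn S D) :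
    Integrable (fun w => (w - S w) ^ 2) ρ ∧
      ∫ w, (w - S w) ^ 2 ∂ρ ≤ 2 * ∫ w, llr ρ (gaussianReal 0 1) w ∂ρ := by
  have hw2 := integrable_sq_of_integrable_llr hac hllr
  have hS2 : Integrable (fun w => S w ^ 2) ρ := by
    have h := (memLp_id_gaussianReal (μ := 0) (v := 1) 2).integrable_sq
    rw [← hmap, integrable_map_measure (by fun_prop) hS.aemeasurable] at h
    exact h
  have hS2' : ∫ w, S w ^ 2 ∂ρ = 1 := by
    rw [← integral_sq_gaussianReal_zero_one, ← hmap,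
      integral_map hS.aemeasurable (by fun_prop)]
  have hwS : Integrable (fun w => w * S w) ρ :=
    ((memLp_two_iff_integrable_sq measurable_id.aestronglyMeasurable).mpr hw2).integrable_mul
      ((memLp_two_iff_integrable_sq hS.aestronglyMeasurable).mpr hS2)
  obtain ⟨hJint, hJ⟩ := integrable_and_integral_setIntegral_Ioi hS hmap hwS
  have hJ0 := setIntegral_Ioi_nonneg hS hmap hD hmono
  have hJD := fun y (hy : y ∈ D) => setIntegral_Ioi_eq_gaussianPDFReal hS hmap hD hmono hy
  set J : ℝ → ℝ := fun y => ∫ w in Ioi y, S w ∂ρ with hJdef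
  set f : ℝ → ℝ := fun y => (ρ.rnDeriv (gaussianReal 0 1) y).toReal with hfdef
  have hfm : Measurable f := by fun_prop
  let φ := gaussianPDFReal 0 1
  have hφ : ∀ x, 0 < φ x := fun x => gaussianPDFReal_pos 0 1 x one_ne_zero
  have hφm : Measurable φ := measurable_gaussianPDFReal 0 1
  have hf0 : ∀ y, 0 ≤ f y := fun _ => ENNReal.toReal_nonneg
  -- For smooth `S` this is `1/S'`. Where `f` vanishes the quotient is `0`, so `hle` is only an
  -- inequality there and rests on `J ≥ 0`.
  let h : ℝ → ℝ := fun y => J y / (f y * φ y)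
  have hle : ∀ y, φ y * (f y * h y) ≤ J y := by
    intro y
    rcases (hf0 y).eq_or_lt with h0 | h0
    · simpa [← h0] using hJ0 y
    · have := (hφ y).ne'
      have := h0.ne'
      exact le_of_eq (by simp only [h]; field_simp)
  have hnn : ∀ y, 0 ≤ φ y * (f y * h y) := fun y =>
    mul_nonneg (hφ y).le (mul_nonneg (hf0 y)
      (div_nonneg (hJ0 y) (mul_nonneg (hf0 y) (hφ y).le)))
  have hint_vol : Integrable fun y => φ y * (f y * h y) := by
    refine hJint.mono' ?_ (ae_of_all _ fun y => ?_)
    · exact hφm.aestronglyMeasurable.mul (hfm.aestronglyMeasurable.mul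
        (hJint.aestronglyMeasurable.div₀ (hfm.mul hφm).aestronglyMeasurable))
    · rw [Real.norm_of_nonneg (hnn y)]
      exact hle y
  have hint : Integrable h ρ := by
    rw [← integrable_rnDeriv_smul_iff hac]
    exact integrable_gaussianReal_zero_one_iff.mpr hint_vol
  have hh : ∫ y, h y ∂ρ ≤ ∫ w, w * S w ∂ρ := by
    rw [← hJ, ← integral_rnDeriv_smul hac, integral_gaussianReal_eq_integral_smul one_ne_zero]
    exact integral_mono hint_vol hJint hle
  have hpt : ∀ᵐ y ∂ρ, 1 - h y + (y ^ 2 - S y ^ 2) / 2 ≤ llr ρ (gaussianReal 0 1) y := by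
    filter_upwards [hD, Measure.rnDeriv_pos hac,
      hac.ae_le (Measure.rnDeriv_lt_top ρ (gaussianReal 0 1))] with y hy hpos hlt
    have hfpos : 0 < f y := ENNReal.toReal_pos hpos.ne' hlt.ne
    -- This is `1 - 1/x ≤ log x` at `x = f φ / φ(S)`, the formal derivative of `S`.
    have hlog := Real.one_sub_inv_le_log_of_pos
      (div_pos (mul_pos hfpos (hφ y)) (hφ (S y)))
    rw [Real.log_div (mul_pos hfpos (hφ y)).ne' (hφ _).ne',
      Real.log_mul hfpos.ne' (hφ y).ne', inv_div] at hlog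
    have hlogφ : ∀ x, Real.log (φ x) = Real.log (√(2 * Real.pi))⁻¹ - x ^ 2 / 2 := by
      intro x
      have hc : (√(2 * Real.pi))⁻¹ ≠ 0 := by positivity
      simp only [φ, gaussianPDFReal, NNReal.coe_one, mul_one, sub_zero]
      rw [Real.log_mul hc (Real.exp_pos _).ne', Real.log_exp]
      ring
    rw [hlogφ, hlogφ] at hlog
    have hhy : h y = φ (S y) / (f y * φ y) := congrArg (· / (f y * φ y)) (hJD y hy)
    rw [hhy, llr]
    change _ ≤ Real.log (f y)
    linarith
  have hsq : Integrable (fun w => (w - S w) ^ 2) ρ :=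
    ((hw2.sub (hwS.const_mul 2)).add hS2).congr
      (ae_of_all _ fun w => by simp only [Pi.add_apply, Pi.sub_apply]; ring)
  refine ⟨hsq, ?_⟩
  have e1 : ∫ w, (w - S w) ^ 2 ∂ρ =
      ∫ w, w ^ 2 ∂ρ - 2 * ∫ w, w * S w ∂ρ + ∫ w, S w ^ 2 ∂ρ := by
    have hd : Integrable (fun w => w ^ 2 - 2 * (w * S w)) ρ := hw2.sub (hwS.const_mul 2)
    rw [← integral_const_mul, ← integral_sub hw2 (hwS.const_mul 2), ← integral_add hd hS2]
    exact integral_congr_ae (ae_of_all _ fun w => by ring)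
  have hd1 : Integrable (fun y => 1 - h y) ρ := (integrable_const 1).sub hint
  have hd2 : Integrable (fun y => (y ^ 2 - S y ^ 2) / 2) ρ := (hw2.sub hS2).div_const 2
  have e2 : ∫ y, (1 - h y + (y ^ 2 - S y ^ 2) / 2) ∂ρ =
      1 - ∫ y, h y ∂ρ + (∫ y, y ^ 2 ∂ρ - ∫ y, S y ^ 2 ∂ρ) / 2 := by
    rw [integral_add hd1 hd2,
      integral_sub (integrable_const 1) hint, integral_div, integral_sub hw2 hS2]
    simp
  have e3 := integral_mono_ae (hd1.add hd2) hllr hpt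
  simp only [Pi.add_apply] at e3
  rw [e2] at e3
  rw [e1]
  linarith

end Monotone

theorem lintegral_sq_sub_monotoneRearrangement_le (ρ : Measure ℝ) [IsProbabilityMeasure ρ] :
    ∫⁻ w, ENNReal.ofReal ((w - monotoneRearrangement ρ (gaussianReal 0 1) w) ^ 2) ∂ρ ≤
      2 * klDiv ρ (gaussianReal 0 1) := by
  by_cases htop : klDiv ρ (gaussianReal 0 1) = ∞
  · simp [htop]
  obtain ⟨hac, hllr⟩ := klDiv_ne_top_iff.mp htop
  have : NullSingletonClass ρ := by
    have := nullSingletonClass_gaussianReal (μ := 0) (v := 1) one_ne_zero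
    exact ⟨fun x => hac (measure_singleton x)⟩
  obtain ⟨hi, hle⟩ := integral_sq_sub_le_integral_llr hac hllr
    (measurable_monotoneRearrangement ρ _) (map_monotoneRearrangement ρ _)
    (ae_cdf_mem_Ioo ρ) (monotoneOn_monotoneRearrangement ρ _)
  rw [← ofReal_integral_eq_lintegral_ofReal hi (ae_of_all _ fun _ => sq_nonneg _),
    ← ENNReal.ofReal_toReal htop, toReal_klDiv_of_measure_eq hac (by simp),
    show (2 : ℝ≥0∞) = ENNReal.ofReal 2 by simp, ← ENNReal.ofReal_mul two_pos.le]
  exact ENNReal.ofReal_le_ofReal hle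

/-! ### The conditional term in the chain rule for relative entropy. -/

/-- The density of the joint laws is the kernel density. In terms of the nonnegative `klFun`,
Tonelli applies without any integrability of the log-likelihood ratio. -/
theorem klDiv_compProd_right_eq_lintegral {α β : Type*} [MeasurableSpace α] [MeasurableSpace β]
    [MeasurableSpace.CountableOrCountablyGenerated α β] {μ : Measure α} [IsFiniteMeasure μ]
    {κ η : Kernel α β} [IsFiniteKernel κ] [IsFiniteKernel η] (hac : ∀ᵐ x ∂μ, κ x ≪ η x) :
    klDiv (μ ⊗ₘ κ) (μ ⊗ₘ η) = ∫⁻ x, klDiv (κ x) (η x) ∂μ := by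
  have hk : Measurable (Function.uncurry (κ.rnDeriv η)) := κ.measurable_rnDeriv η
  have : IsFiniteKernel (η.withDensity (κ.rnDeriv η)) :=
    ⟨⟨κ.bound, κ.bound_lt_top, fun a =>
      (Kernel.withDensity_rnDeriv_le κ η a univ).trans (Kernel.measure_le_bound κ a univ)⟩⟩
  have hκ : μ ⊗ₘ κ = (μ ⊗ₘ η).withDensity (Function.uncurry (κ.rnDeriv η)) := by
    rw [Measure.compProd_congr (η := η.withDensity (κ.rnDeriv η)), Measure.compProd_withDensity hk]
    · rfl
    · filter_upwards [hac] with x hx using (Kernel.withDensity_rnDeriv_eq hx).symm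
  have hrn : (μ ⊗ₘ κ).rnDeriv (μ ⊗ₘ η) =ᵐ[μ ⊗ₘ η] Function.uncurry (κ.rnDeriv η) := by
    rw [hκ]
    exact Measure.rnDeriv_withDensity _ hk
  have hac' : μ ⊗ₘ κ ≪ μ ⊗ₘ η := Measure.absolutelyContinuous_compProd_right_iff.mpr hac
  rw [klDiv_eq_lintegral_klFun_of_ac hac',
    lintegral_congr_ae (g := fun p => ENNReal.ofReal (klFun (κ.rnDeriv η p.1 p.2).toReal)),
    Measure.lintegral_compProd (by fun_prop)]
  · refine lintegral_congr_ae ?_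
    filter_upwards [hac] with x hx
    rw [klDiv_eq_lintegral_klFun_of_ac hx]
    refine lintegral_congr_ae ?_
    filter_upwards [Kernel.rnDeriv_eq_rnDeriv_measure (κ := κ) (η := η) (a := x)] with y hy
    rw [hy]
  · filter_upwards [hrn] with p hp
    rw [hp, Function.uncurry]

/-! ### Adapted maps and the bicausal plans they induce. -/

section Adapted

variable {N : ℕ}

/-- `T` is adapted if its `i`-th coordinate only depends on the coordinates up to `i`. -/
def IsAdaptedMap (T : PathSpace N → PathSpace N) : Prop :=
  ∀ i, Measurable[coordFiltration N i] fun x => T x i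

theorem measurable_coord {i t : Fin N} (h : i ≤ t) :
    Measurable[coordFiltration N t] fun x : PathSpace N => x i := by
  have h1 : Measurable[coordFiltration N t] (Preorder.restrictLe (π := fun _ : Fin N => ℝ) t) :=
    comap_measurable _
  exact (measurable_pi_apply (⟨i, h⟩ : Iic t)).comp h1

theorem measurable_to_coordFiltration {Ω : Type*} {m : MeasurableSpace Ω} {t : Fin N}
    {f : Ω → PathSpace N} (h : ∀ i ≤ t, Measurable[m] fun x => f x i) :
    Measurable[m, coordFiltration N t] f := by
  refine measurable_comap_iff.mpr (measurable_pi_iff.mpr fun j => ?_)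
  exact h j.1 j.2

theorem IsAdaptedMap.measurable_coordFiltration {T : PathSpace N → PathSpace N}
    (hT : IsAdaptedMap T) (t : Fin N) :
    Measurable[coordFiltration N t, coordFiltration N t] T :=
  measurable_to_coordFiltration fun i hi => (hT i).mono ((coordFiltration N).mono hi) le_rfl

theorem IsAdaptedMap.measurable {T : PathSpace N → PathSpace N} (hT : IsAdaptedMap T) :
    Measurable T :=
  measurable_pi_iff.mpr fun i => (hT i).mono ((coordFiltration N).le i) le_rfl

/-- The conditional law of a graph plan is the Dirac mass at `T x`, so `γ^x(B)` is the indicator of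
`T ⁻¹' B`, which lies in the σ-algebra at time `t` when `T` is adapted. -/
theorem mem_causalPlans_of_isAdaptedMap {μ ν : Measure (PathSpace N)} [IsFiniteMeasure μ]
    {T : PathSpace N → PathSpace N} (hT : IsAdaptedMap T) (hmap : μ.map T = ν)
    {γ : ProbabilityMeasure (PathSpace N × PathSpace N)}
    (hγ : (γ : Measure (PathSpace N × PathSpace N)) = μ.map fun x => (x, T x)) :
    γ ∈ causalPlans μ ν := by
  have hTm := hT.measurable
  have hm : Measurable fun x => (x, T x) := measurable_id.prodMk hTm
  refine ⟨⟨?_, ?_⟩, fun t B hB => ?_⟩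
  · rw [hγ, Measure.map_map measurable_fst hm]
    exact Measure.map_id
  · rw [hγ, Measure.map_map measurable_snd hm]
    exact hmap
  · refine ⟨(T ⁻¹' B).indicator fun _ => 1,
      Measurable.indicator measurable_const (hT.measurable_coordFiltration t hB), ?_⟩
    have hB' : MeasurableSet B := (coordFiltration N).le t B hB
    have hfst : (γ : Measure (PathSpace N × PathSpace N)).fst = μ := by
      rw [hγ, Measure.fst, Measure.map_map measurable_fst hm]
      exact Measure.map_id
    have h := eq_condKernel_of_measure_eq_compProd (ρ := (γ : Measure (PathSpace N × PathSpace N)))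
      (Kernel.deterministic T hTm) (by rw [hfst, Measure.compProd_deterministic hTm, hγ])
    rw [hfst] at h
    filter_upwards [h] with x hx
    rw [← hx, Kernel.deterministic_apply' hTm x hB']
    rfl

/-- Exchanging the components turns the graph plan of `T` under `μ` into the graph plan of `S` under
`ν`, so adaptedness of both maps gives both causality conditions. -/
theorem bicausalTransportCost_le_lintegral {μ ν : Measure (PathSpace N)} [IsProbabilityMeasure μ]
    {T S : PathSpace N → PathSpace N} (hT : IsAdaptedMap T) (hS : IsAdaptedMap S)
    (hmap : μ.map T = ν) (hinv : ∀ᵐ x ∂μ, S (T x) = x) :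
    bicausalTransportCost μ ν ≤ ∫⁻ y, quadraticCost (S y, y) ∂ν := by
  have hTm := hT.measurable
  have hSm := hS.measurable
  have hcost : Measurable (quadraticCost (N := N)) := by unfold quadraticCost; fun_prop
  have hm : Measurable fun x => (x, T x) := measurable_id.prodMk hTm
  have hmS : Measurable fun y => (y, S y) := measurable_id.prodMk hSm
  have : IsFiniteMeasure ν := by rw [← hmap]; infer_instance
  let γ : ProbabilityMeasure (PathSpace N × PathSpace N) :=
    ⟨μ.map fun x => (x, T x), Measure.isProbabilityMeasure_map hm.aemeasurable⟩
  have hswap : μ.map (fun x => (T x, x)) = ν.map fun y => (y, S y) := by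
    rw [← hmap, Measure.map_map hmS hTm]
    refine Measure.map_congr ?_
    filter_upwards [hinv] with x hx
    simp [hx]
  have hνμ : ν.map S = μ := by
    rw [← hmap, Measure.map_map hSm hTm]
    exact (Measure.map_congr hinv).trans Measure.map_id
  have hγ : γ ∈ bicausalPlans μ ν := by
    refine ⟨mem_causalPlans_of_isAdaptedMap hT hmap rfl,
      mem_causalPlans_of_isAdaptedMap hS hνμ ?_⟩
    rw [← hswap, ProbabilityMeasure.toMeasure_map]
    exact Measure.map_map measurable_swap hm
  refine (iInf₂_le γ hγ).trans (le_of_eq ?_)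
  change ∫⁻ p, quadraticCost p ∂(μ.map fun x => (x, T x)) = _
  have hcost' : Measurable fun y => quadraticCost (S y, y) :=
    hcost.comp (hSm.prodMk measurable_id)
  rw [lintegral_map hcost hm, ← hmap, lintegral_map hcost' hTm]
  refine lintegral_congr_ae ?_
  filter_upwards [hinv] with x hx
  simp [hx]

end Adapted

/-! ### Splitting off the last coordinate of a path. -/

/-- The path split into its first `N` coordinates and its last one. -/
def splitLast {N : ℕ} (x : PathSpace (N + 1)) : PathSpace N × ℝ :=
  (fun i => x i.castSucc, x (Fin.last N))

/-- The path with first `N` coordinates `p.1` and last coordinate `p.2`. -/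
def joinLast {N : ℕ} (p : PathSpace N × ℝ) : PathSpace (N + 1) :=
  Fin.snoc (α := fun _ => ℝ) p.1 p.2

section Split

variable {N : ℕ}

@[simp] theorem joinLast_castSucc (p : PathSpace N × ℝ) (i : Fin N) :
    joinLast p i.castSucc = p.1 i := Fin.snoc_castSucc _ _ _

@[simp] theorem joinLast_last (p : PathSpace N × ℝ) : joinLast p (Fin.last N) = p.2 :=
  Fin.snoc_last _ _

@[simp] theorem splitLast_joinLast (p : PathSpace N × ℝ) : splitLast (joinLast p) = p := by
  simp [splitLast]

@[simp] theorem joinLast_splitLast (x : PathSpace (N + 1)) : joinLast (splitLast x) = x := by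
  ext i
  refine Fin.lastCases ?_ (fun j => ?_) i <;> simp [splitLast]

theorem measurable_splitLast : Measurable (splitLast (N := N)) := by
  unfold splitLast
  fun_prop

theorem measurable_joinLast : Measurable (joinLast (N := N)) := by
  refine measurable_pi_iff.mpr fun i => ?_
  refine Fin.lastCases ?_ (fun j => ?_) i
  · simpa using measurable_snd
  · simp only [joinLast_castSucc]
    exact (measurable_pi_apply j).comp measurable_fst

theorem map_splitLast_stdGaussianMeasure :
    (stdGaussianMeasure (N + 1)).map splitLast =
      (stdGaussianMeasure N).prod (gaussianReal 0 1) := by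
  have h := measurePreserving_piFinSuccAbove (fun _ : Fin (N + 1) => gaussianReal 0 1) (Fin.last N)
  have h2 := (Measure.measurePreserving_swap.comp h).map_eq
  rw [stdGaussianMeasure, stdGaussianMeasure, ← h2]
  congr 1
  ext x <;> simp [splitLast, Fin.init]

theorem quadraticCost_eq_add_splitLast (x y : PathSpace (N + 1)) :
    quadraticCost (x, y) = quadraticCost ((splitLast x).1, (splitLast y).1) +
      ENNReal.ofReal (((splitLast y).2 - (splitLast x).2) ^ 2) := by
  simp only [quadraticCost, Fin.sum_univ_castSucc, splitLast]
  rw [ENNReal.ofReal_add (Finset.sum_nonneg fun _ _ => sq_nonneg _) (sq_nonneg _),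
    sub_sq_comm (x (Fin.last N))]

theorem isAdaptedMap_joinLast {T : PathSpace N → PathSpace N} (hT : IsAdaptedMap T)
    {h : PathSpace N × ℝ → ℝ} (hh : Measurable h) :
    IsAdaptedMap fun x => joinLast (T (splitLast x).1, h (splitLast x)) := by
  intro i
  refine Fin.lastCases ?_ (fun j => ?_) i
  · simp only [joinLast_last]
    -- At the last time the filtration contains the whole product σ-algebra, so any measurable `h`
    -- is allowed in the last coordinate.
    have hid : Measurable[coordFiltration (N + 1) (Fin.last N)]
        fun x : PathSpace (N + 1) => x :=
      @measurable_pi_iff _ _ _ (coordFiltration (N + 1) (Fin.last N)) _ _ |>.mpr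
        fun k => measurable_coord (Fin.le_last k)
    exact (hh.comp measurable_splitLast).mono (fun s hs => hid hs) le_rfl
  · simp only [joinLast_castSucc]
    refine (hT j).comp (measurable_to_coordFiltration fun k hk => ?_)
    exact measurable_coord (Fin.castSucc_le_castSucc_iff.mpr hk)

end Split

/-! ### Knothe–Rosenblatt recursion and conclusion. -/

instance isProbabilityMeasure_stdGaussianMeasure (N : ℕ) :
    IsProbabilityMeasure (stdGaussianMeasure N) := by
  unfold stdGaussianMeasure
  infer_instance

theorem map_prod_monotoneRearrangement {α : Type*} [MeasurableSpace α] {μ μ' : Measure α}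
    [SFinite μ] [SFinite μ'] (κ : Kernel α ℝ) [IsMarkovKernel κ] (ρ : Measure ℝ)
    [IsProbabilityMeasure ρ] [NullSingletonClass ρ] {T : α → α} (hT : Measurable T)
    (hmap : μ.map T = μ') :
    (μ.prod ρ).map (fun p => (T p.1, monotoneRearrangement ρ (κ (T p.1)) p.2)) = μ' ⊗ₘ κ := by
  have hm : Measurable fun p : α × ℝ => (T p.1, monotoneRearrangement ρ (κ (T p.1)) p.2) :=
    (hT.comp measurable_fst).prodMk (measurable_monotoneRearrangement_kernel_right κ ρ
      (hT.comp measurable_fst) measurable_snd)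
  ext s hs
  rw [Measure.map_apply hm hs, Measure.prod_apply (hm hs), Measure.compProd_apply hs, ← hmap,
    lintegral_map (Kernel.measurable_kernel_prodMk_left hs) hT]
  refine lintegral_congr fun x => ?_
  conv_rhs => rw [← map_monotoneRearrangement ρ (κ (T x)),
    Measure.map_apply (measurable_monotoneRearrangement ρ _) (measurable_prodMk_left hs)]
  rfl

/-- Absolute continuity with respect to the atomless `ρ` makes almost every conditional law
atomless, which the fibrewise inversion requires. -/
theorem ae_monotoneRearrangement_kernel_leftInverse {α : Type*} [MeasurableSpace α]
    {μ : Measure α} [SFinite μ] (κ : Kernel α ℝ) [IsMarkovKernel κ]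
    (ρ : Measure ℝ) [IsProbabilityMeasure ρ] [NullSingletonClass ρ] {T S : α → α}
    (hT : Measurable T) (hinv : ∀ᵐ x ∂μ, S (T x) = x)
    (hac : ∀ᵐ x ∂(μ.map T), κ x ≪ ρ) :
    ∀ᵐ p ∂(μ.prod ρ), S (T p.1) = p.1 ∧
      monotoneRearrangement (κ (T p.1)) ρ (monotoneRearrangement ρ (κ (T p.1)) p.2) = p.2 := by
  have hT' : Measurable fun p : α × ℝ => T p.1 := hT.comp measurable_fst
  have hms : Measurable fun p : α × ℝ =>
      monotoneRearrangement (κ (T p.1)) ρ (monotoneRearrangement ρ (κ (T p.1)) p.2) :=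
    measurable_monotoneRearrangement_kernel_left κ ρ hT'
      (measurable_monotoneRearrangement_kernel_right κ ρ hT' measurable_snd)
  have h1 : ∀ᵐ p ∂(μ.prod ρ), S (T p.1) = p.1 := Measure.quasiMeasurePreserving_fst.ae hinv
  have hset : MeasurableSet {p : α × ℝ | monotoneRearrangement (κ (T p.1)) ρ
      (monotoneRearrangement ρ (κ (T p.1)) p.2) = p.2} :=
    measurableSet_eq_fun hms measurable_snd
  have h2 : ∀ᵐ p ∂(μ.prod ρ), monotoneRearrangement (κ (T p.1)) ρ
      (monotoneRearrangement ρ (κ (T p.1)) p.2) = p.2 := by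
    rw [← Measure.compProd_const, Measure.ae_compProd_iff hset]
    filter_upwards [ae_of_ae_map hT.aemeasurable hac] with x hκx
    have : NullSingletonClass (κ (T x)) := ⟨fun z => hκx (measure_singleton z)⟩
    exact ae_monotoneRearrangement_leftInverse ρ (κ (T x))
  filter_upwards [h1, h2] with p hp hp' using ⟨hp, hp'⟩

theorem lintegral_quadraticCost_joinLast {N : ℕ} {ν : Measure (PathSpace (N + 1))}
    [IsProbabilityMeasure ν] {S : PathSpace N → PathSpace N} (hS : Measurable S)
    {h : PathSpace N × ℝ → ℝ} (hh : Measurable h) :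
    ∫⁻ y, quadraticCost (joinLast (S (splitLast y).1, h (splitLast y)), y) ∂ν =
      ∫⁻ y, quadraticCost (S y, y) ∂(ν.map splitLast).fst +
        ∫⁻ y, ∫⁻ w, ENNReal.ofReal ((w - h (y, w)) ^ 2)
          ∂((ν.map splitLast).condKernel y) ∂(ν.map splitLast).fst := by
  have hc : Measurable fun y : PathSpace N => quadraticCost (S y, y) := by
    unfold quadraticCost
    fun_prop
  have hc' : Measurable fun p : PathSpace N × ℝ => quadraticCost (S p.1, p.1) :=
    hc.comp measurable_fst
  have hm : Measurable fun p : PathSpace N × ℝ => ENNReal.ofReal ((p.2 - h p) ^ 2) := by fun_prop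
  have hadd : Measurable fun p : PathSpace N × ℝ =>
      quadraticCost (S p.1, p.1) + ENNReal.ofReal ((p.2 - h p) ^ 2) := hc'.add hm
  rw [Measure.lintegral_condKernel hm, Measure.fst, lintegral_map hc measurable_fst,
    ← lintegral_add_left hc', lintegral_map hadd measurable_splitLast]
  refine lintegral_congr fun y => ?_
  rw [quadraticCost_eq_add_splitLast, splitLast_joinLast]

/-- Knothe–Rosenblatt rearrangement of the Gaussian measure onto `ν`. -/
theorem exists_isAdaptedMap_lintegral_quadraticCost_le (N : ℕ) :
    ∀ (ν : Measure (PathSpace N)) [IsProbabilityMeasure ν], ν ≪ stdGaussianMeasure N →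
      ∃ T S : PathSpace N → PathSpace N, IsAdaptedMap T ∧ IsAdaptedMap S ∧
        (stdGaussianMeasure N).map T = ν ∧ (∀ᵐ x ∂(stdGaussianMeasure N), S (T x) = x) ∧
        ∫⁻ y, quadraticCost (S y, y) ∂ν ≤ 2 * klDiv ν (stdGaussianMeasure N) := by
  induction N with
  | zero =>
    intro ν _ _
    refine ⟨id, id, fun i => i.elim0, fun i => i.elim0, ?_, ae_of_all _ fun _ => rfl, ?_⟩
    · rw [Measure.map_id]
      ext s
      rcases s.eq_empty_or_nonempty with rfl | hs
      · simp
      · simp [Subsingleton.eq_univ_of_nonempty hs]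
    · simp [quadraticCost]
  | succ N ih =>
    intro ν _ hac
    have : NullSingletonClass (gaussianReal 0 1) := nullSingletonClass_gaussianReal one_ne_zero
    set g := gaussianReal 0 1
    have := Measure.isProbabilityMeasure_map (μ := ν) measurable_splitLast.aemeasurable
    set ν₂ := ν.map splitLast with hν₂
    set κ := ν₂.condKernel
    have hdis : ν₂.fst ⊗ₘ κ = ν₂ := ν₂.disintegrate κ
    have hprod : (stdGaussianMeasure (N + 1)).map splitLast =
        stdGaussianMeasure N ⊗ₘ Kernel.const (PathSpace N) g := by
      rw [map_splitLast_stdGaussianMeasure, Measure.compProd_const]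
    have hac₂ : ν₂.fst ⊗ₘ κ ≪ stdGaussianMeasure N ⊗ₘ Kernel.const (PathSpace N) g := by
      rw [hdis, ← hprod]
      exact hac.map measurable_splitLast
    have hac₁ := Measure.absolutelyContinuous_of_compProd hac₂
    have hacκ : ∀ᵐ x ∂ν₂.fst, κ x ≪ Kernel.const (PathSpace N) g x := hac₂.kernel_of_compProd
    have hkl : klDiv ν₂.fst (stdGaussianMeasure N) + ∫⁻ x, klDiv (κ x) g ∂ν₂.fst ≤
        klDiv ν (stdGaussianMeasure (N + 1)) := by
      -- Data processing under `splitLast`, then the chain rule. Only this direction is needed,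
      -- although `splitLast` is bijective and loses no entropy.
      have h := klDiv_map_le (μ := ν) (ν := stdGaussianMeasure (N + 1)) measurable_splitLast
      rw [hprod, ← hν₂, ← hdis, klDiv_compProd_eq_add, klDiv_compProd_right_eq_lintegral hacκ] at h
      simpa using h
    obtain ⟨T, S, hT, hS, hmap, hinv, hcost⟩ := ih ν₂.fst hac₁
    have hTm := hT.measurable
    have hSm := hS.measurable
    have hMT : Measurable fun p : PathSpace N × ℝ =>
        monotoneRearrangement g (κ (T p.1)) p.2 :=
      measurable_monotoneRearrangement_kernel_right κ g (hTm.comp measurable_fst) measurable_snd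
    have hMS : Measurable fun p : PathSpace N × ℝ => monotoneRearrangement (κ p.1) g p.2 :=
      measurable_monotoneRearrangement_kernel_left κ g measurable_fst measurable_snd
    have hTl := isAdaptedMap_joinLast hT hMT
    have hSl := isAdaptedMap_joinLast hS hMS
    refine ⟨_, _, hTl, hSl, ?_, ?_, ?_⟩
    · have hm : Measurable fun p : PathSpace N × ℝ =>
          (T p.1, monotoneRearrangement g (κ (T p.1)) p.2) :=
        (hTm.comp measurable_fst).prodMk hMT
      calc (stdGaussianMeasure (N + 1)).map _
          = (((stdGaussianMeasure (N + 1)).map splitLast).map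
              fun p => (T p.1, monotoneRearrangement g (κ (T p.1)) p.2)).map joinLast := by
            rw [Measure.map_map hm measurable_splitLast,
              Measure.map_map measurable_joinLast (hm.comp measurable_splitLast)]
            rfl
        _ = ν₂.map joinLast := by
            rw [map_splitLast_stdGaussianMeasure, map_prod_monotoneRearrangement κ g hTm hmap, hdis]
        _ = ν := by
            rw [hν₂, Measure.map_map measurable_joinLast measurable_splitLast]
            convert! Measure.map_id
            ext1 x
            simp
    · have key := ae_monotoneRearrangement_kernel_leftInverse κ g hTm hinv (by rwa [hmap])
      rw [← map_splitLast_stdGaussianMeasure] at key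
      filter_upwards [ae_of_ae_map measurable_splitLast.aemeasurable key] with x hx
      simp only [splitLast_joinLast, hx.1, hx.2]
      exact joinLast_splitLast x
    · rw [lintegral_quadraticCost_joinLast hSm hMS]
      calc ∫⁻ y, quadraticCost (S y, y) ∂ν₂.fst + ∫⁻ y, ∫⁻ w,
              ENNReal.ofReal ((w - monotoneRearrangement (κ y) g w) ^ 2) ∂(κ y) ∂ν₂.fst
          ≤ 2 * klDiv ν₂.fst (stdGaussianMeasure N) + ∫⁻ y, 2 * klDiv (κ y) g ∂ν₂.fst :=
            add_le_add hcost
              (lintegral_mono fun y => lintegral_sq_sub_monotoneRearrangement_le (κ y))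
        _ = 2 * (klDiv ν₂.fst (stdGaussianMeasure N) + ∫⁻ y, klDiv (κ y) g ∂ν₂.fst) := by
            rw [lintegral_const_mul' _ _ (by simp), mul_add]
        _ ≤ 2 * klDiv ν (stdGaussianMeasure (N + 1)) := by gcongr

theorem mainTheorem9 (N : ℕ) (ν : Measure (PathSpace N)) [IsProbabilityMeasure ν] :
    bicausalTransportCost (stdGaussianMeasure N) ν ≤ 2 * klDiv ν (stdGaussianMeasure N) ∧
      transportCost (stdGaussianMeasure N) ν ≤
        bicausalTransportCost (stdGaussianMeasure N) ν := by
  refine ⟨?_, biInf_mono fun γ hγ => hγ.1.1⟩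
  by_cases hac : ν ≪ stdGaussianMeasure N
  · obtain ⟨T, S, hT, hS, hmap, hinv, hcost⟩ :=
      exists_isAdaptedMap_lintegral_quadraticCost_le N ν hac
    exact (bicausalTransportCost_le_lintegral hT hS hmap hinv).trans hcost
  · simp [klDiv_of_not_ac hac]
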